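/- Let $X$ be a locally compact Hausdorff space, let $2^X$ be the set of all closed subsets of $X$ (including $\emptyset$), and let $\mathsf F$ be the Fell topology on $2^X$, i.e. the topology generated by the sets $\{F\in 2^X : F\cap U\neq\emptyset\}$ with $U\subset X$ open and $\{F\in 2^X : F\cap K=\emptyset\}$ with $K\subset X$ compact. Then the following are equivalent: (a) $(2^X,\mathsf F)$ has countable tightness; (b) $(2^X,\mathsf F)$ has the Reznichenko property; (c) $(2^X,\mathsf F)$ has the Pytkeev property; (d) $X$ is hereditarily separable and hereditarily Lindelöf, i.e. every subspace of $X$ is separable and every subspace of $X$ is Lindelöf. Here a space $Y$ has *countable tightness* if for all $A\subset Y$ and $y\in\overline{A}$ there is a countable $B\subset A$ with $y\in\overline{B}$. It has the *Reznichenko property* if for all $A\subset Y$ and $y\in\overline{A}\setminus A$ there is a countably infinite family $\mathcal A$ of pairwise disjoint finite subsets of $A$ such that each neighbourhood of $y$ meets all but finitely many members of $\mathcal A$. It has the *Pytkeev property* if for all $A\subset Y$ and $y\in\overline{A\setminus\{y\}}$ there are countably infinite sets $A_n\subset A$, $n\in\mathbb N$, such that each neighbourhood of $y$ contains some $A_n$.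 -/

import Mathlib

open Set Filter Topology TopologicalSpace

/-- Countable tightness: a point in the closure of `A` lies in the closure of a countable
subset of `A`. -/
def HasCountableTightness (Y : Type*) [TopologicalSpace Y] : Prop :=
  ∀ (A : Set Y) (y : Y), y ∈ closure A → ∃ B : Set Y, B ⊆ A ∧ B.Countable ∧ y ∈ closure B

/-- The Reznichenko property: for `y ∈ closure A \ A` there is a countably infinite family of
pairwise disjoint finite subsets of `A` such that every neighbourhood of `y` meets all but
finitely many members of the family. -/
def HasReznichenkoProperty (Y : Type*) [TopologicalSpace Y] : Prop :=
  ∀ (A : Set Y) (y : Y), y ∈ closure A \ A →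
    ∃ 𝒜 : Set (Set Y), 𝒜.Countable ∧ 𝒜.Infinite ∧
      (∀ B ∈ 𝒜, B.Finite ∧ B ⊆ A) ∧
      (∀ B ∈ 𝒜, ∀ C ∈ 𝒜, B ≠ C → Disjoint B C) ∧
      ∀ U ∈ 𝓝 y, {B ∈ 𝒜 | ¬ (B ∩ U).Nonempty}.Finite

/-- The Pytkeev property: for `y ∈ closure (A \ {y})` there is a sequence of countably infinite
subsets of `A` that is a `π`-network at `y`. -/
def HasPytkeevProperty (Y : Type*) [TopologicalSpace Y] : Prop :=
  ∀ (A : Set Y) (y : Y), y ∈ closure (A \ {y}) →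
    ∃ B : ℕ → Set Y, (∀ n, B n ⊆ A ∧ (B n).Countable ∧ (B n).Infinite) ∧
      ∀ U ∈ 𝓝 y, ∃ n, B n ⊆ U

/-- Every subspace of `X` is separable. -/
def IsHereditarilySeparableSpace (X : Type*) [TopologicalSpace X] : Prop :=
  ∀ s : Set X, SeparableSpace s

/-- The lower Vietoris topology on the closed subsets of `X`, generated by the sets
`{F | F ∩ U ≠ ∅}` with `U` open. -/
abbrev lowerVietoris (X : Type*) [TopologicalSpace X] : TopologicalSpace (Closeds X) :=
  generateFrom {S | ∃ U : Set X, IsOpen U ∧ S = {F : Closeds X | ((F : Set X) ∩ U).Nonempty}}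

/-- The upper Fell (co-compact) topology on the closed subsets of `X`, generated by the sets
`{F | F ⊆ Kᶜ}` with `K` compact. -/
abbrev upperFell (X : Type*) [TopologicalSpace X] : TopologicalSpace (Closeds X) :=
  generateFrom {S | ∃ K : Set X, IsCompact K ∧ S = {F : Closeds X | (F : Set X) ⊆ Kᶜ}}

/-- The set `2^X` of all closed subsets of `X` (including the empty set), to be equipped with
the Fell topology. -/
def FellHyperspace (X : Type*) [TopologicalSpace X] : Type _ := Closeds X

/-- The Fell topology: the coarsest topology finer than both the lower Vietoris and the upper
Fell topology (in Mathlib's order on topologies this is the infimum). -/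
instance FellHyperspace.instTopologicalSpace (X : Type*) [TopologicalSpace X] :
    TopologicalSpace (FellHyperspace X) :=
  (lowerVietoris X ⊓ upperFell X : TopologicalSpace (Closeds X))

/-! The implications (c) ⇒ (b) ⇒ (a) hold in every space. For (a) ⇒ (d), two nets indexed by finite
sets converge in the Fell topology: finite subsets of `S` tend to `closure S`, and complements of
finite subunions of an open family tend to the complement of its union. Countable tightness thins
each net to countably many terms, giving a countable dense subset or a countable subcover. For (d) ⇒
(c), the hyperspace is even first countable (`FellHyperspace.firstCountableTopology`), and T1 first
countable spaces are Pytkeev. -/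

namespace FellHyperspace

variable {X : Type*} [TopologicalSpace X]

/-- The underlying set of a point of the Fell hyperspace. -/
def toSet (F : FellHyperspace X) : Set X := Closeds.carrier F

/-- A closed set as a point of the Fell hyperspace. -/
def ofClosed (s : Set X) (hs : IsClosed s) : FellHyperspace X := (⟨s, hs⟩ : Closeds X)

@[simp]
theorem toSet_ofClosed (s : Set X) (hs : IsClosed s) : (ofClosed s hs).toSet = s := rfl

theorem isClosed_toSet (F : FellHyperspace X) : IsClosed F.toSet := Closeds.isClosed' F

theorem toSet_injective : Function.Injective (toSet (X := X)) :=
  fun _ _ h ↦ Closeds.ext h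

theorem isOpen_hit {U : Set X} (hU : IsOpen U) :
    IsOpen {F : FellHyperspace X | (F.toSet ∩ U).Nonempty} :=
  (inf_le_left : lowerVietoris X ⊓ upperFell X ≤ lowerVietoris X) _
    (isOpen_generateFrom_of_mem ⟨U, hU, rfl⟩)

theorem isOpen_miss {K : Set X} (hK : IsCompact K) :
    IsOpen {F : FellHyperspace X | F.toSet ⊆ Kᶜ} :=
  (inf_le_right : lowerVietoris X ⊓ upperFell X ≤ upperFell X) _
    (isOpen_generateFrom_of_mem ⟨K, hK, rfl⟩)

theorem tendsto_nhds_of_hit_of_miss {ι : Type*} {l : Filter ι} {f : ι → FellHyperspace X}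
    {F : FellHyperspace X}
    (hit : ∀ U : Set X, IsOpen U → (F.toSet ∩ U).Nonempty → ∀ᶠ i in l, ((f i).toSet ∩ U).Nonempty)
    (miss : ∀ K : Set X, IsCompact K → F.toSet ⊆ Kᶜ → ∀ᶠ i in l, (f i).toSet ⊆ Kᶜ) :
    Tendsto f l (𝓝 F) := by
  have h : 𝓝 F = @nhds (Closeds X) (lowerVietoris X) F ⊓ @nhds (Closeds X) (upperFell X) F :=
    nhds_inf (α := Closeds X)
  rw [h]
  refine tendsto_inf.2 ⟨tendsto_nhds_generateFrom_iff.2 ?_, tendsto_nhds_generateFrom_iff.2 ?_⟩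
  · rintro _ ⟨U, hU, rfl⟩ hF
    exact hit U hU hF
  · rintro _ ⟨K, hK, rfl⟩ hF
    exact miss K hK hF

instance instT1Space [T1Space X] : T1Space (FellHyperspace X) := by
  refine t1Space_iff_exists_open.2 fun F G hFG ↦ ?_
  have hne : F.toSet ≠ G.toSet := toSet_injective.ne hFG
  by_cases h : F.toSet ⊆ G.toSet
  · obtain ⟨x, hxG, hxF⟩ := not_subset.1 fun h' ↦ hne (h.antisymm h')
    exact ⟨_, isOpen_miss (isCompact_singleton (x := x)), by simpa using hxF, by simpa using hxG⟩
  · obtain ⟨x, hxF, hxG⟩ := not_subset.1 h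
    refine ⟨_, isOpen_hit G.isClosed_toSet.isOpen_compl, ⟨x, hxF, hxG⟩, ?_⟩
    rintro ⟨y, hy, hy'⟩
    exact hy' hy

end FellHyperspace

section CountabilityProperties

variable {Y : Type*} [TopologicalSpace Y]

/-- Since each `B i` is infinite, the `n`-th block can meet `B 0, ..., B n` while avoiding all
earlier blocks. If `B n ⊆ U`, every block from the `n`-th on meets `U`. -/
theorem HasPytkeevProperty.hasReznichenkoProperty (h : HasPytkeevProperty Y) :
    HasReznichenkoProperty Y := by
  rintro A y ⟨hy, hyA⟩
  obtain ⟨B, hB, hBU⟩ := h A y (by rwa [sdiff_singleton_eq_self hyA])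
  have step (n : ℕ) (E : Finset Y) :
      ∃ C : Finset Y, ↑C ⊆ A ∧ Disjoint C E ∧ ∀ i ≤ n, ((C : Set Y) ∩ B i).Nonempty := by
    classical
    have ex (i : ℕ) : ∃ x ∈ B i, x ∉ E := (hB i).2.2.exists_notMem_finset E
    choose x hxB hxE using ex
    refine ⟨(Finset.range (n + 1)).image x, ?_, ?_, fun i hi ↦ ⟨x i, ?_, hxB i⟩⟩
    · intro z hz
      obtain ⟨i, -, rfl⟩ := Finset.mem_image.1 (Finset.mem_coe.1 hz)
      exact (hB i).1 (hxB i)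
    · refine Finset.disjoint_left.2 fun z hz ↦ ?_
      obtain ⟨i, -, rfl⟩ := Finset.mem_image.1 hz
      exact hxE i
    · exact Finset.mem_coe.2 (Finset.mem_image_of_mem _ (Finset.mem_range.2 (by omega)))
  classical
  choose C hCA hCE hCB using step
  -- `E n` is the union of the blocks of index below `n`.
  let E : ℕ → Finset Y := fun n ↦ Nat.rec ∅ (fun n E ↦ E ∪ C n E) n
  have hE (n : ℕ) : E (n + 1) = E n ∪ C n (E n) := rfl
  have hEmono : Monotone E := monotone_nat_of_le_succ fun n ↦ by
    rw [hE]; exact Finset.subset_union_left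
  let D : ℕ → Set Y := fun n ↦ C n (E n)
  have hD {m n : ℕ} (hmn : m < n) : Disjoint (D m) (D n) := by
    refine Finset.disjoint_coe.2 (((hCE n (E n)).mono_right ?_).symm)
    exact Finset.subset_union_right.trans ((hE m).symm.subset.trans (hEmono hmn))
  have hDne (n : ℕ) : (D n).Nonempty := (hCB n (E n) n le_rfl).mono inter_subset_left
  have hDisj : Pairwise fun m n ↦ Disjoint (D m) (D n) := fun m n hmn ↦
    hmn.lt_or_gt.elim hD fun h ↦ (hD h).symm
  have hinj : Function.Injective D := fun m n hmn ↦ by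
    by_contra hne
    have : Disjoint (D m) (D n) := hDisj hne
    rw [hmn, disjoint_self] at this
    exact (hDne n).ne_empty this
  refine ⟨range D, countable_range D, infinite_range_of_injective hinj, ?_, ?_, fun U hU ↦ ?_⟩
  · rintro _ ⟨n, rfl⟩
    exact ⟨Finset.finite_toSet _, hCA n _⟩
  · rintro _ ⟨m, rfl⟩ _ ⟨n, rfl⟩ hne
    exact hDisj fun h ↦ hne (congrArg D h)
  · obtain ⟨n, hn⟩ := hBU U hU
    refine ((finite_Iio n).image D).subset ?_
    rintro _ ⟨⟨m, rfl⟩, hm⟩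
    refine ⟨m, mem_Iio.2 <| not_le.1 fun hnm ↦ hm ?_, rfl⟩
    exact (hCB m (E m) n hnm).mono (inter_subset_inter_right _ hn)

theorem HasReznichenkoProperty.hasCountableTightness (h : HasReznichenkoProperty Y) :
    HasCountableTightness Y := by
  intro A y hy
  by_cases hyA : y ∈ A
  · exact ⟨{y}, singleton_subset_iff.2 hyA, countable_singleton y, subset_closure rfl⟩
  obtain ⟨𝒜, hc, hi, hA, -, hU⟩ := h A y ⟨hy, hyA⟩
  refine ⟨⋃₀ 𝒜, sUnion_subset fun B hB ↦ (hA B hB).2,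
    hc.sUnion fun B hB ↦ (hA B hB).1.countable, mem_closure_iff_nhds.2 fun U hUy ↦ ?_⟩
  obtain ⟨B, hB, hBU⟩ := (hi.sdiff (hU U hUy)).nonempty
  obtain ⟨x, hxB, hxU⟩ : (B ∩ U).Nonempty := by
    by_contra hne
    exact hBU ⟨hB, hne⟩
  exact ⟨x, hxU, B, hB, hxB⟩

theorem hasPytkeevProperty_of_firstCountable [T1Space Y] [FirstCountableTopology Y] :
    HasPytkeevProperty Y := by
  intro A y hy
  obtain ⟨V, hV⟩ := (𝓝 y).exists_antitone_basis
  have ex (n : ℕ) : ∃ B ⊆ V n ∩ (A \ {y}), B.Countable ∧ B.Infinite := by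
    -- By T1, a finite trace could be removed from `V n`, leaving a neighbourhood of `y` disjoint
    -- from `A \ {y}`.
    have hinf : (V n ∩ (A \ {y})).Infinite := by
      intro hfin
      have hW : V n ∩ (V n ∩ (A \ {y}))ᶜ ∈ 𝓝 y :=
        inter_mem (hV.mem n) (hfin.isClosed.isOpen_compl.mem_nhds fun h ↦ h.2.2 rfl)
      obtain ⟨x, hx, hxA⟩ := mem_closure_iff_nhds.1 hy _ hW
      exact hx.2 ⟨hx.1, hxA⟩
    let e := hinf.natEmbedding
    refine ⟨range fun k ↦ (e k : Y), ?_, countable_range _,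
      infinite_range_of_injective (Subtype.val_injective.comp e.injective)⟩
    rintro _ ⟨k, rfl⟩
    exact (e k).2
  choose B hB hBc hBi using ex
  refine ⟨B, fun n ↦ ⟨fun x hx ↦ (hB n hx).2.1, hBc n, hBi n⟩, fun U hU ↦ ?_⟩
  obtain ⟨n, hn⟩ := hV.mem_iff.1 hU
  exact ⟨n, fun x hx ↦ hn (hB n hx).1⟩

end CountabilityProperties

section Fell

variable {X : Type*} [TopologicalSpace X]

theorem HasCountableTightness.isHereditarilySeparableSpace [T1Space X]
    (h : HasCountableTightness (FellHyperspace X)) : IsHereditarilySeparableSpace X := by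
  intro S
  let f : Finset S → FellHyperspace X := fun t ↦
    .ofClosed (Subtype.val '' (t : Set S)) (t.finite_toSet.image _).isClosed
  have hf : Tendsto f atTop (𝓝 (.ofClosed (closure S) isClosed_closure)) := by
    refine FellHyperspace.tendsto_nhds_of_hit_of_miss (fun U hU hne ↦ ?_) fun K _ hS ↦ ?_
    · obtain ⟨x, hxS, hxU⟩ := hne
      obtain ⟨z, hzU, hzS⟩ := mem_closure_iff.1 hxS U hU hxU
      filter_upwards [eventually_ge_atTop {⟨z, hzS⟩}] with t ht
      exact ⟨z, ⟨⟨z, hzS⟩, ht (Finset.mem_singleton_self _), rfl⟩, hzU⟩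
    · refine .of_forall fun t ↦ ?_
      rintro _ ⟨z, -, rfl⟩
      exact hS (subset_closure z.2)
  obtain ⟨B, hBf, hBc, hB⟩ := h (range f) _
    (mem_closure_of_tendsto hf (.of_forall mem_range_self))
  choose g hg using fun F : B ↦ hBf F.2
  have : Countable B := hBc
  refine ⟨⟨⋃ F, (g F : Set S), countable_iUnion fun F ↦ (g F).countable_toSet, ?_⟩⟩
  rw [Subtype.dense_iff]
  intro x hx
  refine mem_closure_iff.2 fun U hU hxU ↦ ?_
  obtain ⟨F, hF, hFB⟩ := mem_closure_iff.1 hB _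
    (FellHyperspace.isOpen_hit hU) ⟨x, subset_closure hx, hxU⟩
  rw [← show f (g ⟨F, hFB⟩) = F from hg ⟨F, hFB⟩] at hF
  obtain ⟨_, ⟨z, hz, rfl⟩, hzU⟩ := hF
  exact ⟨z, hzU, z, mem_iUnion_of_mem ⟨F, hFB⟩ hz, rfl⟩

theorem HasCountableTightness.hereditarilyLindelofSpace
    (h : HasCountableTightness (FellHyperspace X)) : HereditarilyLindelofSpace X := by
  refine ⟨fun S _ ↦ isLindelof_of_countable_subcover fun {ι} U hU hS ↦ ?_⟩
  let f : Finset ι → FellHyperspace X := fun t ↦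
    .ofClosed (⋃ i ∈ t, U i)ᶜ (isOpen_biUnion fun i _ ↦ hU i).isClosed_compl
  have hf : Tendsto f atTop (𝓝 (.ofClosed (⋃ i, U i)ᶜ (isOpen_iUnion hU).isClosed_compl)) := by
    refine FellHyperspace.tendsto_nhds_of_hit_of_miss (fun V _ hne ↦ ?_) fun K hK hKU ↦ ?_
    · refine .of_forall fun t ↦ hne.mono (inter_subset_inter_left _ ?_)
      exact compl_subset_compl.2 (iUnion₂_subset_iUnion _ _)
    · obtain ⟨t, ht⟩ := hK.elim_finite_subcover U hU (compl_subset_compl.1 hKU)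
      filter_upwards [eventually_ge_atTop t] with t' htt'
      exact compl_subset_compl.2 (ht.trans (biUnion_subset_biUnion_left htt'))
  obtain ⟨B, hBf, hBc, hB⟩ := h (range f) _
    (mem_closure_of_tendsto hf (.of_forall mem_range_self))
  choose g hg using fun F : B ↦ hBf F.2
  have : Countable B := hBc
  refine ⟨⋃ F, (g F : Set ι), countable_iUnion fun F ↦ (g F).countable_toSet, fun x hx ↦ ?_⟩
  -- Missing the compact set `{x}` means that the finite subunion contains `x`.
  obtain ⟨F, hF, hFB⟩ := mem_closure_iff.1 hB _
    (FellHyperspace.isOpen_miss (isCompact_singleton (x := x)))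
    (by simpa using mem_iUnion.1 (hS hx))
  rw [← show f (g ⟨F, hFB⟩) = F from hg ⟨F, hFB⟩] at hF
  obtain ⟨i, hi, hxi⟩ := mem_iUnion₂.1 (not_not.1 fun h' ↦ hF h' rfl : x ∈ ⋃ i ∈ g ⟨F, hFB⟩, U i)
  exact mem_biUnion (mem_iUnion_of_mem ⟨F, hFB⟩ hi) hxi

/-- In a locally compact hereditarily Lindelöf space every open set is hemicompact. -/
theorem IsOpen.exists_hemicompact_exhaustion [T2Space X] [LocallyCompactSpace X]
    [HereditarilyLindelofSpace X] {U : Set X} (hU : IsOpen U) :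
    ∃ K : ℕ → Set X, (∀ n, IsCompact (K n) ∧ K n ⊆ U) ∧
      ∀ C, IsCompact C → C ⊆ U → ∃ n, C ⊆ K n := by
  have : LocallyCompactSpace U := hU.locallyCompactSpace
  have : SigmaCompactSpace U := by
    choose N hN hNx using fun x : U ↦ exists_compact_mem_nhds x
    obtain ⟨t, htc, -, ht⟩ := (isLindelof_univ (X := U)).elim_nhds_subcover N fun x _ ↦ hNx x
    refine .of_countable (N '' t) (htc.image N) (forall_mem_image.2 fun x _ ↦ hN x) ?_
    rw [sUnion_image]
    exact univ_subset_iff.1 ht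
  -- Each term lies in the interior of the next, so every compact subset of `U` is absorbed by a
  -- single term.
  let K := CompactExhaustion.choice U
  refine ⟨fun n ↦ Subtype.val '' K n, fun n ↦ ⟨(K.isCompact n).image continuous_subtype_val,
    Subtype.coe_image_subset _ _⟩, fun C hC hCU ↦ ?_⟩
  obtain ⟨n, hn⟩ := K.exists_superset_of_isCompact
    (s := Subtype.val ⁻¹' C) (Topology.IsInducing.subtypeVal.isCompact_preimage_iff
      (by simpa using hCU) |>.2 hC)
  exact ⟨n, fun x hx ↦ ⟨⟨x, hCU hx⟩, hn hx, rfl⟩⟩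

/-- With `L` a compact neighbourhood of `x` and `K n` exhausting `{x}ᶜ`, the sets `L \ K n` form a
base at `x`: some `K n` absorbs the compact set `L \ interior U`. -/
theorem firstCountableTopology_of_hereditarilyLindelof [T2Space X] [LocallyCompactSpace X]
    [HereditarilyLindelofSpace X] : FirstCountableTopology X := by
  refine ⟨fun x ↦ ?_⟩
  obtain ⟨L, hL, hLx⟩ := exists_compact_mem_nhds x
  obtain ⟨K, hK, hKC⟩ := (isOpen_compl_singleton (x := x)).exists_hemicompact_exhaustion
  have hb : (𝓝 x).HasBasis (fun _ : ℕ ↦ True) fun n ↦ L \ K n := by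
    refine ⟨fun U ↦ ⟨fun hU ↦ ?_, fun ⟨n, _, hn⟩ ↦ mem_of_superset ?_ hn⟩⟩
    · obtain ⟨n, hn⟩ := hKC (L \ interior U) (hL.diff isOpen_interior) fun z hz hzx ↦ by
        rw [mem_singleton_iff.1 hzx] at hz
        exact hz.2 (mem_interior_iff_mem_nhds.2 hU)
      refine ⟨n, trivial, fun z hz ↦ ?_⟩
      by_contra hzU
      exact hz.2 (hn ⟨hz.1, fun h ↦ hzU (interior_subset h)⟩)
    · exact inter_mem hLx ((hK n).1.isClosed.isOpen_compl.mem_nhds fun h ↦ (hK n).2 h rfl)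
  exact hb.isCountablyGenerated

/-- Hit conditions need testing only on countable bases at the points of a countable dense subset of
`F`, and miss conditions only on a hemicompact exhaustion of the complement of `F`. -/
theorem FellHyperspace.firstCountableTopology [T2Space X] [LocallyCompactSpace X]
    [HereditarilyLindelofSpace X] (hs : IsHereditarilySeparableSpace X) :
    FirstCountableTopology (FellHyperspace X) := by
  have : FirstCountableTopology X := firstCountableTopology_of_hereditarilyLindelof
  refine ⟨fun F ↦ ?_⟩
  have := hs F.toSet
  obtain ⟨D, hDc, hD⟩ := exists_countable_dense F.toSet
  obtain ⟨K, hK, hKC⟩ := F.isClosed_toSet.isOpen_compl.exists_hemicompact_exhaustion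
  choose V hV using fun x : X ↦ (𝓝 x).exists_antitone_basis
  let hits : Set (Set (FellHyperspace X)) :=
    ⋃ d ∈ D, range fun n ↦ {G | (G.toSet ∩ interior (V d n)).Nonempty}
  let misses : Set (Set (FellHyperspace X)) := range fun n ↦ {G | G.toSet ⊆ (K n)ᶜ}
  refine ⟨⟨hits ∪ misses, (hDc.biUnion fun d _ ↦ countable_range _).union (countable_range _),
    le_antisymm (le_generate_iff.2 ?_) ?_⟩⟩
  · rintro _ (h | ⟨n, rfl⟩)
    · obtain ⟨d, -, n, rfl⟩ := mem_iUnion₂.1 h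
      exact (isOpen_hit isOpen_interior).mem_nhds
        ⟨d, d.2, mem_interior_iff_mem_nhds.2 ((hV d).mem n)⟩
    · exact (isOpen_miss (hK n).1).mem_nhds (subset_compl_comm.1 (hK n).2)
  · refine tendsto_id'.1 (tendsto_nhds_of_hit_of_miss (fun U hU hne ↦ ?_) fun C hC hFC ↦ ?_)
    · obtain ⟨x, hxF, hxU⟩ := hne
      obtain ⟨d, hdU, hdD⟩ := hD.inter_open_nonempty (Subtype.val ⁻¹' U)
        (hU.preimage continuous_subtype_val) ⟨⟨x, hxF⟩, hxU⟩
      obtain ⟨n, hn⟩ := (hV d).mem_iff.1 (hU.mem_nhds hdU)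
      refine mem_of_superset (mem_generate_of_mem (.inl (mem_biUnion hdD ⟨n, rfl⟩))) fun G hG ↦ ?_
      exact hG.mono (inter_subset_inter_right _ (interior_subset.trans hn))
    · obtain ⟨n, hn⟩ := hKC C hC (subset_compl_comm.1 hFC)
      refine mem_of_superset (mem_generate_of_mem (.inr ⟨n, rfl⟩)) fun G hG ↦ ?_
      exact hG.trans (compl_subset_compl.2 hn)

end Fell

theorem mainTheorem7 {X : Type*} [TopologicalSpace X] [T2Space X] [LocallyCompactSpace X] :
    List.TFAE [
      HasCountableTightness (FellHyperspace X),
      HasReznichenkoProperty (FellHyperspace X),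
      HasPytkeevProperty (FellHyperspace X),
      IsHereditarilySeparableSpace X ∧ HereditarilyLindelofSpace X] := by
  tfae_have 3 → 2 := fun h ↦ h.hasReznichenkoProperty
  tfae_have 2 → 1 := fun h ↦ h.hasCountableTightness
  tfae_have 1 → 4 := fun h ↦ ⟨h.isHereditarilySeparableSpace, h.hereditarilyLindelofSpace⟩
  tfae_have 4 → 3 := fun ⟨hs, _⟩ ↦
    have := FellHyperspace.firstCountableTopology hs
    hasPytkeevProperty_of_firstCountable
  tfae_finish
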